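/- Let $n\ge 0$, equip $\mathbb Z^n$ with the standard dot product, and let $\Lambda\subset\mathbb Z^n$ be a full-rank sublattice that has a basis of $n$ pairwise orthogonal vectors. Call $\Lambda$ cubiquitous if $\Lambda\cap(x+\{0,1\}^n)\neq\emptyset$ for every $x\in\mathbb Z^n$. Then $\Lambda$ is cubiquitous if and only if there exist a basis $b_1,\dots,b_n$ of $\Lambda$ and a $\mathbb Z$-basis $f_1,\dots,f_n$ of $\mathbb Z^n$ that is orthonormal for the dot product (that is, $f_1,\dots,f_n$ are the standard basis vectors up to order and signs) such that the $n\times n$ matrix whose $j$-th column consists of the coordinates of $b_j$ with respect to $f_1,\dots,f_n$ is block diagonal, each diagonal block being one of $$\begin{bmatrix}1\end{bmatrix},\qquad \begin{bmatrix}2\end{bmatrix},\qquad \begin{bmatrix}1&-1\\1&1\end{bmatrix}.$$ -/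

import Mathlib

namespace CubLat

/-- A sublattice `Λ` of `ℤⁿ` is orthogonal if it has a basis of `n` pairwise orthogonal vectors for
the standard dot product. Since the basis is indexed by `Fin n`, such a `Λ` has full rank `n`. -/
def IsOrthogonalSublattice {n : ℕ} (Λ : Submodule ℤ (Fin n → ℤ)) : Prop :=
  ∃ v : Module.Basis (Fin n) ℤ Λ,
    ∀ i j, i ≠ j → (v i : Fin n → ℤ) ⬝ᵥ (v j : Fin n → ℤ) = 0

/-- `Λ` is cubiquitous if it meets every unit cube `x + {0,1}ⁿ`, `x ∈ ℤⁿ`. -/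
def IsCubiquitous {n : ℕ} (Λ : Submodule ℤ (Fin n → ℤ)) : Prop :=
  ∀ x : Fin n → ℤ, ∃ c : Fin n → ℤ, (∀ i, c i = 0 ∨ c i = 1) ∧ x + c ∈ Λ

/-- A change of basis of the lattice `(ℤⁿ, dot product)`: a `ℤ`-basis of `ℤⁿ` that is orthonormal
for the dot product (equivalently, the vectors `±e₁, …, ±eₙ` in some order). -/
def IsOrthonormalBasis {n : ℕ} (e : Module.Basis (Fin n) ℤ (Fin n → ℤ)) : Prop :=
  ∀ i j, e i ⬝ᵥ e j = if i = j then 1 else 0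

/-- The three kinds of diagonal blocks. -/
inductive Block
  | one
  | two
  | rot

namespace Block

/-- The number of rows (and columns) of a block. -/
def size : Block → ℕ
  | one => 1
  | two => 1
  | rot => 2

/-- The blocks as integer matrices. -/
def mat : (β : Block) → Matrix (Fin β.size) (Fin β.size) ℤ
  | one => (!![1] : Matrix (Fin 1) (Fin 1) ℤ)
  | two => (!![2] : Matrix (Fin 1) (Fin 1) ℤ)
  | rot => (!![1, -1; 1, 1] : Matrix (Fin 2) (Fin 2) ℤ)

end Block

/-- `M` is block diagonal, with consecutive diagonal blocks `β 0, β 1, …, β (m - 1)`, each of which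
is `[1]`, `[2]` or `[[1, -1], [1, 1]]`. -/
def IsBlockMatrix {n : ℕ} (M : Matrix (Fin n) (Fin n) ℤ) : Prop :=
  ∃ (m : ℕ) (β : Fin m → Block) (h : ∑ k, (β k).size = n),
    M = Matrix.reindex (finSigmaFinEquiv.trans (finCongr h)) (finSigmaFinEquiv.trans (finCongr h))
      (Matrix.blockDiagonal' fun k => (β k).mat)

end CubLat

namespace CubLat

open Finset

/-! For an orthogonal basis `v`, every `x ∈ Λ` satisfies `v i ⬝ᵥ v i ∣ x ⬝ᵥ v i`. Cubiquity thus
makes these congruences solvable, simultaneously in `i`, in every unit cube, and the forward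
direction uses only that.

Over a cube, `c ⬝ᵥ v i` ranges over an interval whose length is the `ℓ¹` norm of `v i`. Placing the
cube just past a multiple of `v i ⬝ᵥ v i` bounds the squared length, so `v i` is `±2` times a unit
vector or has entries in `{0, ±1}` (`CubeCondition.entries`). A cube at an extremal corner for `v i`
leaves no freedom on the support of `v i`; testing a second vector there shows that overlapping
supports coincide and have two elements (`CubeCondition.supp_eq_of_overlap`). A coordinate met by
only one basis vector forces that vector to be a multiple of a unit vector. Hence the supports
partition the coordinates into blocks, and signs normalize each block.

Conversely, orthonormal integral bases are signed permutations, so unit cubes become products of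
sets `{0, ±1}`, and each block can be solved separately by a parity argument. -/

/-- The divisibility data that a cubiquitous lattice with orthogonal basis `v` provides. -/
def CubeCondition {n : ℕ} (v : Fin n → Fin n → ℤ) : Prop :=
  ∀ x : Fin n → ℤ, ∃ c : Fin n → ℤ, (∀ i, c i = 0 ∨ c i = 1) ∧ ∀ i, v i ⬝ᵥ v i ∣ (x + c) ⬝ᵥ v i

/-! ### Congruences and nondegeneracy from orthogonality -/

theorem dvd_dotProduct_of_mem {n : ℕ} {Λ : Submodule ℤ (Fin n → ℤ)}
    (v : Module.Basis (Fin n) ℤ Λ)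
    (hv : ∀ i j, i ≠ j → (v i : Fin n → ℤ) ⬝ᵥ (v j : Fin n → ℤ) = 0)
    {x : Fin n → ℤ} (hx : x ∈ Λ) (i : Fin n) :
    (v i : Fin n → ℤ) ⬝ᵥ (v i : Fin n → ℤ) ∣ x ⬝ᵥ (v i : Fin n → ℤ) := by
  have h : x = ∑ k, v.repr ⟨x, hx⟩ k • (v k : Fin n → ℤ) := by
    have := congrArg Λ.subtype (v.sum_repr ⟨x, hx⟩)
    simpa only [map_sum, map_smul, Submodule.subtype_apply] using this.symm
  rw [h, sum_dotProduct]
  refine Finset.dvd_sum fun k _ => ?_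
  rw [smul_dotProduct]
  by_cases hk : k = i
  · subst hk; exact Dvd.intro_left _ rfl
  · simp [hv k i hk]

theorem IsCubiquitous.cubeCondition {n : ℕ} {Λ : Submodule ℤ (Fin n → ℤ)}
    (h : IsCubiquitous Λ) (v : Module.Basis (Fin n) ℤ Λ)
    (hv : ∀ i j, i ≠ j → (v i : Fin n → ℤ) ⬝ᵥ (v j : Fin n → ℤ) = 0) :
    CubeCondition fun i => (v i : Fin n → ℤ) := fun x => by
  obtain ⟨c, hc, hm⟩ := h x
  exact ⟨c, hc, dvd_dotProduct_of_mem v hv hm⟩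

/-- The Gram matrix is diagonal with nonzero entries, so the matrix of `v` has nonzero determinant.
-/
theorem eq_zero_of_orthogonal {n : ℕ} {v : Fin n → Fin n → ℤ} (h0 : ∀ i, v i ≠ 0)
    (hv : ∀ i j, i ≠ j → v i ⬝ᵥ v j = 0) {x : Fin n → ℤ} (hx : ∀ i, v i ⬝ᵥ x = 0) : x = 0 := by
  have hd : (Matrix.of v) * (Matrix.of v).transpose = Matrix.diagonal fun i => v i ⬝ᵥ v i := by
    ext i j
    by_cases hij : i = j
    · subst hij; simp [Matrix.mul_apply, dotProduct]
    · rw [Matrix.diagonal_apply_ne _ hij, ← hv i j hij]; simp [Matrix.mul_apply, dotProduct]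
  have hdet : (Matrix.of v).det ≠ 0 := by
    intro h
    have := congrArg Matrix.det hd
    rw [Matrix.det_mul, h, zero_mul, Matrix.det_diagonal] at this
    obtain ⟨i, -, hi⟩ := Finset.prod_eq_zero_iff.1 this.symm
    exact h0 i (dotProduct_self_eq_zero.1 hi)
  refine Matrix.eq_zero_of_mulVec_eq_zero hdet ?_
  ext i
  exact hx i

/-! ### Size of the entries -/

/-- Squared length is at most the `ℓ¹` length plus any positive attained value. -/
theorem CubeCondition.sum_sq_le {n : ℕ} {v : Fin n → Fin n → ℤ} (h : CubeCondition v) (i : Fin n)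
    {u : Fin n → ℤ} (hu : 0 < u ⬝ᵥ v i) : v i ⬝ᵥ v i ≤ ∑ a, |v i a| + u ⬝ᵥ v i := by
  -- The indicator of the positive entries maximizes `c ⬝ᵥ v i` over the cube. With this corner all
  -- values are at most `-(u ⬝ᵥ v i) < 0`, so the multiple found is a negative one.
  obtain ⟨c, hc, hd⟩ := h (-(fun a => if 0 < v i a then 1 else 0) - u)
  obtain ⟨k, hk⟩ := hd i
  set p : Fin n → ℤ := fun a => if 0 < v i a then 1 else 0 with hp
  have e : (-p - u + c) ⬝ᵥ v i = -((p - c) ⬝ᵥ v i) - u ⬝ᵥ v i := by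
    simp only [add_dotProduct, sub_dotProduct, neg_dotProduct]; ring
  have hb : ∀ a, 0 ≤ (p a - c a) * v i a ∧ (p a - c a) * v i a ≤ |v i a| := by
    intro a
    simp only [hp]
    rcases hc a with h | h <;> split_ifs with hv <;> rw [h]
    · simp [le_abs_self, hv.le]
    · simp
    · simp
    · have := not_lt.1 hv
      rw [abs_of_nonpos this]; constructor <;> linarith
  have h1 : 0 ≤ (p - c) ⬝ᵥ v i := Finset.sum_nonneg fun a _ => (hb a).1
  have h2 : (p - c) ⬝ᵥ v i ≤ ∑ a, |v i a| := Finset.sum_le_sum fun a _ => (hb a).2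
  have h3 : 0 ≤ v i ⬝ᵥ v i := Finset.sum_nonneg fun a _ => mul_self_nonneg _
  have hk0 : k < 0 := by
    by_contra hk0
    have := mul_nonneg h3 (not_lt.1 hk0)
    linarith
  nlinarith

/-- Taking `u = ±e_a` in `sum_sq_le` bounds the sum of the nonnegative terms `|z|² - |z|` by every
nonzero `|v i a|`. An entry of absolute value 2 already exhausts this bound. -/
theorem CubeCondition.entries {n : ℕ} {v : Fin n → Fin n → ℤ} (h : CubeCondition v) (i : Fin n) :
    (∃ a, |v i a| = 2 ∧ ∀ b, b ≠ a → v i b = 0) ∨ ∀ a, |v i a| ≤ 1 := by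
  have hf : ∀ a, 0 ≤ |v i a| * |v i a| - |v i a| := fun a => by
    rcases eq_or_ne (v i a) 0 with h0 | h0
    · simp [h0]
    · nlinarith [Int.one_le_abs h0]
  have key : ∀ a, v i a ≠ 0 → ∑ b, (|v i b| * |v i b| - |v i b|) ≤ |v i a| := by
    intro a ha
    have e : Pi.single a (SignType.sign (v i a) : ℤ) ⬝ᵥ v i = |v i a| := by
      rw [single_dotProduct]; exact sign_mul_self _
    have := h.sum_sq_le i (u := Pi.single a (SignType.sign (v i a) : ℤ))
      (by rw [e]; exact abs_pos.2 ha)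
    rw [e] at this
    simp only [sum_sub_distrib, abs_mul_abs_self]
    simp only [dotProduct] at this
    linarith
  by_cases hall : ∀ a, |v i a| ≤ 1
  · exact Or.inr hall
  push Not at hall
  obtain ⟨a, ha⟩ := hall
  have ha0 : v i a ≠ 0 := by rintro h0; simp [h0] at ha
  have h1 := (Finset.single_le_sum (fun b _ => hf b) (mem_univ a)).trans (key a ha0)
  have h2 : |v i a| = 2 := by nlinarith
  refine Or.inl ⟨a, h2, fun b hb => by_contra fun hb0 => ?_⟩
  have h3 := (Finset.single_le_sum (fun b _ => hf b) (mem_univ a)).trans (key b hb0)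
  have h4 : (|v i a| * |v i a| - |v i a|) + (|v i b| * |v i b| - |v i b|) ≤ |v i a| := by
    refine le_trans ?_ (key a ha0)
    rw [← Finset.sum_pair (f := fun b => |v i b| * |v i b| - |v i b|) hb.symm]
    exact Finset.sum_le_sum_of_subset_of_nonneg (subset_univ _) fun b _ _ => hf b
  rw [h2] at h3 h4
  nlinarith

/-! ### Overlapping supports -/

/-- The support of an integer vector. -/
def supp {n : ℕ} (w : Fin n → ℤ) : Finset (Fin n) := {a | w a ≠ 0}

@[simp] theorem mem_supp {n : ℕ} {w : Fin n → ℤ} {a : Fin n} : a ∈ supp w ↔ w a ≠ 0 := by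
  simp [supp]

theorem sq_eq_one_of_abs_le_one {z : ℤ} (h : |z| ≤ 1) (h0 : z ≠ 0) : z * z = 1 := by
  have := Int.one_le_abs h0
  have h1 : |z| = 1 := le_antisymm h this
  rw [← abs_mul_abs_self, h1]; rfl

theorem dotProduct_self_eq_card_supp {n : ℕ} {w : Fin n → ℤ} (h : ∀ a, |w a| ≤ 1) :
    w ⬝ᵥ w = (supp w).card := by
  rw [Finset.card_eq_sum_ones, Nat.cast_sum, supp, Finset.sum_filter]
  refine Finset.sum_congr rfl fun a _ => ?_
  split_ifs with h0
  · simpa using sq_eq_one_of_abs_le_one (h a) h0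
  · simp [not_not.1 h0]

/-- On the kernel of the character of `v i`, the other characters only see the coordinates
outside the support of `v i`. -/
theorem CubeCondition.exists_dvd_sub_sum {n : ℕ} {v : Fin n → Fin n → ℤ} (h : CubeCondition v)
    {i j : Fin n} (hij : v i ⬝ᵥ v j = 0) (hi : ∀ a, |v i a| ≤ 1)
    {y : Fin n → ℤ} (hy : v i ⬝ᵥ v i ∣ y ⬝ᵥ v i) :
    ∃ c : Fin n → ℤ, (∀ a, c a = 0 ∨ c a = 1) ∧
      v j ⬝ᵥ v j ∣ y ⬝ᵥ v j - ∑ a ∈ (supp (v i))ᶜ, c a * v j a := by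
  obtain ⟨c, hc, hd⟩ := h (-(fun a => if 0 < v i a then 1 else 0) - y)
  set p : Fin n → ℤ := fun a => if 0 < v i a then 1 else 0 with hp
  have e : ∀ k, (-p - y + c) ⬝ᵥ v k = -((p - c) ⬝ᵥ v k) - y ⬝ᵥ v k := fun k => by
    simp only [add_dotProduct, sub_dotProduct, neg_dotProduct]; ring
  have hdi : v i ⬝ᵥ v i ∣ (p - c) ⬝ᵥ v i := by
    have := dvd_add (hd i) hy
    rw [e, sub_add_cancel, dvd_neg] at this
    exact this
  have hb : ∀ a ∈ supp (v i), (p a - c a) * v i a = 0 ∨ (p a - c a) * v i a = 1 := by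
    intro a ha
    have ha0 := mem_supp.1 ha
    have := abs_le.1 (hi a)
    have h1 : v i a = 1 ∨ v i a = -1 := by omega
    simp only [hp]
    rcases hc a with h | h <;> rcases h1 with h1 | h1 <;> simp [h, h1]
  have hsum : (p - c) ⬝ᵥ v i = ∑ a ∈ supp (v i), (p a - c a) * v i a := by
    refine (Finset.sum_subset (subset_univ _) fun a _ ha => ?_).symm
    simp only [mem_supp, not_not] at ha
    simp [ha]
  -- A sum of `card (supp (v i))` terms in `{0, 1}` divisible by their number has all terms equal.
  -- So `p - c` is `ε • v i` on the support, which `v j` does not see.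
  have hε : ∃ ε : ℤ, ∀ a ∈ supp (v i), (p a - c a) * v i a = ε := by
    rw [dotProduct_self_eq_card_supp hi, hsum] at hdi
    set t := ∑ a ∈ supp (v i), (p a - c a) * v i a with ht
    have h0 : 0 ≤ t := Finset.sum_nonneg fun a ha => by rcases hb a ha with h | h <;> simp [h]
    rcases h0.eq_or_lt with h0 | h0
    · refine ⟨0, fun a ha => ?_⟩
      refine (Finset.sum_eq_zero_iff_of_nonneg ?_).1 h0.symm a ha
      intro a ha
      rcases hb a ha with h | h <;> simp [h]
    · refine ⟨1, fun a ha => ?_⟩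
      have h1 := Int.le_of_dvd h0 hdi
      have h2 : ∑ a ∈ supp (v i), (1 - (p a - c a) * v i a) = 0 := by
        refine le_antisymm ?_ (Finset.sum_nonneg fun a ha => ?_)
        · rw [Finset.sum_sub_distrib, ← ht]; simpa using h1
        · rcases hb a ha with h | h <;> simp [h]
      have := (Finset.sum_eq_zero_iff_of_nonneg ?_).1 h2 a ha
      · linarith
      · intro a ha
        rcases hb a ha with h | h <;> simp [h]
  obtain ⟨ε, hε⟩ := hε
  refine ⟨c, hc, ?_⟩
  have hpc : (p - c) ⬝ᵥ v j = -∑ a ∈ (supp (v i))ᶜ, c a * v j a := by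
    rw [dotProduct, ← Finset.sum_add_sum_compl (supp (v i)), ← Finset.sum_neg_distrib]
    have h1 : ∑ a ∈ supp (v i), (p - c) a * v j a = ε * (v i ⬝ᵥ v j) := by
      rw [dotProduct, Finset.mul_sum, ← Finset.sum_subset (subset_univ (supp (v i)))]
      · refine Finset.sum_congr rfl fun a ha => ?_
        have h1 := sq_eq_one_of_abs_le_one (hi a) (mem_supp.1 ha)
        rw [← hε a ha, Pi.sub_apply]
        linear_combination (-(p a - c a) * v j a) * h1
      · intro a _ ha
        simp only [mem_supp, not_not] at ha
        simp [ha]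
    rw [h1, hij, mul_zero, zero_add]
    refine Finset.sum_congr rfl fun a ha => ?_
    simp only [mem_compl, mem_supp, not_not] at ha
    simp [hp, ha]
  have := dvd_neg.2 (hd j)
  rw [e, hpc] at this
  rwa [neg_neg, neg_sub] at this

/-- Orthogonality forces a second common coordinate, so `v j` has at least two nonzero entries on
`supp (v i)`. The entries outside are then too few to reach all residues modulo `v j ⬝ᵥ v j`. -/
theorem CubeCondition.supp_subset {n : ℕ} {v : Fin n → Fin n → ℤ} (h : CubeCondition v)
    {i j : Fin n} (hij : v i ⬝ᵥ v j = 0) (hi : ∀ a, |v i a| ≤ 1) (hj : ∀ a, |v j a| ≤ 1)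
    {a₀ : Fin n} (hi₀ : v i a₀ ≠ 0) (hj₀ : v j a₀ ≠ 0) : supp (v j) ⊆ supp (v i) := by
  intro k hk
  by_contra hki
  have hk0 := mem_supp.1 hk
  simp only [mem_supp, not_not] at hki
  obtain ⟨a₁, ha₁, hne⟩ : ∃ a₁, v i a₁ * v j a₁ ≠ 0 ∧ a₁ ≠ a₀ := by
    by_contra! hcon
    have : v i ⬝ᵥ v j = v i a₀ * v j a₀ :=
      Finset.sum_eq_single a₀ (fun b _ hb => by_contra fun hb0 => hb (hcon b hb0)) (by simp)
    rw [hij] at this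
    exact mul_ne_zero hi₀ hj₀ this.symm
  set U := (supp (v i))ᶜ with hU
  -- One more than the largest value of `∑ a ∈ U, c a * v j a`: the difference then lies strictly
  -- between 0 and `v j ⬝ᵥ v j`.
  set t : ℤ := ∑ a ∈ U, (if 0 < v j a then 1 else 0) * v j a + 1 with ht
  obtain ⟨c, hc, hd⟩ := h.exists_dvd_sub_sum hij hi (y := Pi.single k (t * v j k))
    (by simp [single_dotProduct, hki])
  have hy : Pi.single k (t * v j k) ⬝ᵥ v j = t := by
    rw [single_dotProduct, mul_assoc, sq_eq_one_of_abs_le_one (hj k) hk0, mul_one]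
  rw [hy, dotProduct_self_eq_card_supp hj] at hd
  have e : t - ∑ a ∈ U, c a * v j a
      = ∑ a ∈ U, ((if 0 < v j a then 1 else 0) - c a) * v j a + 1 := by
    simp only [ht, sub_mul, Finset.sum_sub_distrib]; ring
  have hb : ∀ a, 0 ≤ ((if 0 < v j a then 1 else 0) - c a) * v j a ∧
      ((if 0 < v j a then 1 else 0) - c a) * v j a ≤ if v j a ≠ 0 then 1 else 0 := by
    intro a
    have := abs_le.1 (hj a)
    have h1 : v j a = 0 ∨ v j a = 1 ∨ v j a = -1 := by omega
    rcases hc a with h | h <;> rcases h1 with h1 | h1 | h1 <;> simp [h, h1]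
  have h1 : 0 ≤ ∑ a ∈ U, ((if 0 < v j a then 1 else 0) - c a) * v j a :=
    Finset.sum_nonneg fun a _ => (hb a).1
  have h2 : ∑ a ∈ U, ((if 0 < v j a then 1 else 0) - c a) * v j a
      ≤ ((supp (v j) \ {a₀, a₁}).card : ℤ) := by
    refine (Finset.sum_le_sum fun a _ => (hb a).2).trans ?_
    rw [Finset.sum_boole]
    norm_cast
    refine Finset.card_le_card fun a ha => ?_
    simp only [hU, mem_filter, mem_compl, mem_supp, not_not] at ha
    simp only [mem_sdiff, mem_supp, mem_insert, mem_singleton, not_or]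
    refine ⟨ha.2, ?_, ?_⟩
    · rintro rfl; exact hi₀ ha.1
    · rintro rfl; exact ha₁ (by simp [ha.1])
  have h3 : (supp (v j) \ {a₀, a₁}).card + 2 = (supp (v j)).card := by
    have hs : ({a₀, a₁} : Finset (Fin n)) ⊆ supp (v j) := by
      intro a ha
      simp only [mem_insert, mem_singleton] at ha
      rcases ha with rfl | rfl
      · simpa using hj₀
      · simpa using right_ne_zero_of_mul ha₁
    rw [← Finset.card_pair hne.symm, Finset.card_sdiff_add_card_eq_card hs]
  rw [e] at hd
  have := Int.le_of_dvd (by linarith) hd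
  omega

theorem CubeCondition.card_supp_eq_two {n : ℕ} {v : Fin n → Fin n → ℤ} (h : CubeCondition v)
    {i j : Fin n} (hij : v i ⬝ᵥ v j = 0) (hi : ∀ a, |v i a| ≤ 1) (hj : ∀ a, |v j a| ≤ 1)
    (hs : supp (v j) = supp (v i)) {a : Fin n} (ha : v j a ≠ 0) : (supp (v j)).card = 2 := by
  have hval : ∀ a, v i a * v j a = 0 ∨ v i a * v j a = 1 ∨ v i a * v j a = -1 := fun a => by
    have h1 := abs_le.1 (hi a)
    have h2 := abs_le.1 (hj a)
    have h1 : v i a = 0 ∨ v i a = 1 ∨ v i a = -1 := by omega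
    have h2 : v j a = 0 ∨ v j a = 1 ∨ v j a = -1 := by omega
    rcases h1 with h1 | h1 | h1 <;> rcases h2 with h2 | h2 | h2 <;> simp [h1, h2]
  have hia : v i a ≠ 0 := mem_supp.1 (hs ▸ mem_supp.2 ha)
  have hne := mul_ne_zero hia ha
  have hb : ∃ b, v i b * v j b = - (v i a * v j a) := by
    by_contra! hcon
    have : ∀ b ∈ univ, 0 ≤ (v i a * v j a) * (v i b * v j b) := fun b _ => by
      have h1 := hcon b
      rcases hval a with h | h | h <;> rcases hval b with h' | h' | h' <;>
        rw [h, h'] at h1 ⊢ <;> simp_all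
    have hz : ∑ b, (v i a * v j a) * (v i b * v j b) = 0 := by
      rw [← Finset.mul_sum]; exact mul_eq_zero_of_right _ hij
    exact mul_ne_zero hne hne ((Finset.sum_eq_zero_iff_of_nonneg this).1 hz a (mem_univ a))
  obtain ⟨b, hb⟩ := hb
  have hib : v i b ≠ 0 := by
    intro h0
    rw [h0, zero_mul] at hb
    exact hne (by linarith)
  have hjb : v j b ≠ 0 := mem_supp.1 (hs ▸ mem_supp.2 hib)
  have hab : a ≠ b := by
    rintro rfl
    exact hne (by linarith)
  -- This `y` is orthogonal to `v i` and pairs with `v j` to `±2`, while the sum off the common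
  -- support vanishes; so the squared length of `v j` divides 2.
  obtain ⟨c, -, hd⟩ := h.exists_dvd_sub_sum hij hi
    (y := Pi.single a (v i a) - Pi.single b (v i b)) (by
      rw [sub_dotProduct, single_dotProduct, single_dotProduct,
        sq_eq_one_of_abs_le_one (hi a) hia, sq_eq_one_of_abs_le_one (hi b) hib, sub_self]
      exact dvd_zero _)
  rw [Finset.sum_eq_zero, sub_zero, sub_dotProduct, single_dotProduct, single_dotProduct, hb,
    dotProduct_self_eq_card_supp hj] at hd
  · have h2 : ((supp (v j)).card : ℤ) ∣ 2 := by
      rcases hval a with h | h | h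
      · exact absurd h hne
      · simpa [h] using hd
      · rw [h] at hd; simpa using (dvd_neg.2 hd)
    refine le_antisymm (by exact_mod_cast Int.le_of_dvd two_pos h2) ?_
    rw [← Finset.card_pair hab]
    refine Finset.card_le_card fun x hx => ?_
    simp only [mem_insert, mem_singleton] at hx
    rcases hx with rfl | rfl <;> simpa
  · intro x hx
    rw [← hs] at hx
    simp only [mem_compl, mem_supp, not_not] at hx
    simp [hx]

theorem CubeCondition.supp_eq_of_overlap {n : ℕ} {v : Fin n → Fin n → ℤ} (h : CubeCondition v)
    (hv : ∀ i j, i ≠ j → v i ⬝ᵥ v j = 0) {i j a : Fin n} (hij : i ≠ j)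
    (hi : v i a ≠ 0) (hj : v j a ≠ 0) :
    supp (v j) = supp (v i) ∧ (supp (v i)).card = 2 ∧ ∀ b, |v i b| ≤ 1 := by
  have key : ∀ i j, i ≠ j → v i a ≠ 0 → v j a ≠ 0 → ∀ b, |v i b| ≤ 1 := by
    intro i j hij hi hj
    refine (h.entries i).resolve_left ?_
    rintro ⟨a', -, ha'⟩
    have haa : a = a' := by_contra fun hne => hi (ha' a hne)
    subst haa
    have : v i ⬝ᵥ v j = v i a * v j a :=
      Finset.sum_eq_single a (fun b _ hb => by simp [ha' b hb]) (by simp)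
    rw [hv i j hij] at this
    exact mul_ne_zero hi hj this.symm
  have h1 := key i j hij hi hj
  have h2 := key j i hij.symm hj hi
  have hs := (h.supp_subset (hv i j hij) h1 h2 hi hj).antisymm
    (h.supp_subset (hv j i hij.symm) h2 h1 hj hi)
  exact ⟨hs, hs ▸ h.card_supp_eq_two (hv i j hij) h1 h2 hs hj, h1⟩

/-- The vector `(v i ⬝ᵥ v i) e_a - v i a • v i` is orthogonal to every `v j`, hence zero. -/
theorem supp_eq_singleton {n : ℕ} {v : Fin n → Fin n → ℤ} (h0 : ∀ i, v i ≠ 0)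
    (hv : ∀ i j, i ≠ j → v i ⬝ᵥ v j = 0) {i a : Fin n} (hi : v i a ≠ 0)
    (hj : ∀ j, j ≠ i → v j a = 0) : supp (v i) = {a} := by
  have hx : Pi.single a (v i ⬝ᵥ v i) - v i a • v i = 0 := by
    refine eq_zero_of_orthogonal h0 hv fun j => ?_
    rw [dotProduct_sub, dotProduct_single, dotProduct_smul]
    by_cases hji : j = i
    · subst hji; simp
    · simp [hj j hji, hv j i hji]
  ext b
  simp only [mem_supp, mem_singleton]
  refine ⟨fun hb => by_contra fun hba => ?_, fun hb => hb ▸ hi⟩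
  have := congrFun hx b
  simp [hba, hi, hb] at this

theorem exists_supp_mem {n : ℕ} {v : Fin n → Fin n → ℤ} (h0 : ∀ i, v i ≠ 0)
    (hv : ∀ i j, i ≠ j → v i ⬝ᵥ v j = 0) (a : Fin n) : ∃ i, a ∈ supp (v i) := by
  by_contra! hcon
  have := eq_zero_of_orthogonal h0 hv (x := Pi.single a 1) fun i => by
    simpa [dotProduct_single] using hcon i
  simpa using congrFun this a

/-! ### Normalizing and assembling blocks -/

/-- Signed permutations bringing a family of vectors into the shape of one block. -/
def IsSignedBlock {n : ℕ} (v : Fin n → Fin n → ℤ) (A I : Fin n → Prop) : Prop :=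
  ∃ (β : Block) (ρ : Fin β.size ≃ {a // A a}) (κ : Fin β.size ≃ {i // I i})
    (s t : Fin β.size → ℤˣ), ∀ p q, (s p : ℤ) * (t q * v (κ q) (ρ p)) = β.mat p q

theorem exists_equiv_fin_one {α : Type*} {P : α → Prop} {a : α} (h : ∀ x, P x ↔ x = a) :
    ∃ e : Fin 1 ≃ {x // P x}, ∀ p, (e p : α) = a := by
  refine ⟨⟨fun _ => ⟨a, (h a).2 rfl⟩, fun _ => 0, fun p => (Subsingleton.elim _ _), fun x => ?_⟩,
    fun p => rfl⟩
  exact Subtype.ext ((h x).1 x.2).symm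

theorem exists_equiv_fin_two {α : Type*} {P : α → Prop} {a b : α} (hab : a ≠ b)
    (h : ∀ x, P x ↔ x = a ∨ x = b) :
    ∃ e : Fin 2 ≃ {x // P x}, (e 0 : α) = a ∧ (e 1 : α) = b := by
  let f : Fin 2 → {x // P x} := ![⟨a, (h a).2 (Or.inl rfl)⟩, ⟨b, (h b).2 (Or.inr rfl)⟩]
  have hf : Function.Bijective f := by
    constructor
    · intro x y hxy
      fin_cases x <;> fin_cases y <;> simp_all [f, hab.symm]
    · rintro ⟨x, hx⟩
      rcases (h x).1 hx with rfl | rfl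
      · exact ⟨0, rfl⟩
      · exact ⟨1, rfl⟩
  exact ⟨Equiv.ofBijective f hf, rfl, rfl⟩

theorem isSignedBlock_singleton {n : ℕ} {v : Fin n → Fin n → ℤ} {A I : Fin n → Prop}
    {a i : Fin n} (hA : ∀ x, A x ↔ x = a) (hI : ∀ x, I x ↔ x = i)
    (hv : |v i a| = 1 ∨ |v i a| = 2) : IsSignedBlock v A I := by
  obtain ⟨ρ, hρ⟩ := exists_equiv_fin_one hA
  obtain ⟨κ, hκ⟩ := exists_equiv_fin_one hI
  obtain ⟨s, hs⟩ : ∃ s : ℤˣ, (s : ℤ) * v i a = |v i a| := by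
    rcases abs_choice (v i a) with h | h
    · exact ⟨1, by simp [h]⟩
    · exact ⟨-1, by simp [h]⟩
  have key : ∀ p q : Fin 1, (s : ℤ) * (((1 : ℤˣ) : ℤ) * v (κ q) (ρ p)) = |v i a| := fun p q => by
    rw [hρ, hκ, Units.val_one, one_mul, hs]
  rcases hv with h | h
  · refine ⟨Block.one, ρ, κ, fun _ => s, fun _ => 1, fun (p q : Fin 1) => ?_⟩
    refine (key p q).trans (h.trans ?_)
    rw [Subsingleton.elim p 0, Subsingleton.elim q 0]
    rfl
  · refine ⟨Block.two, ρ, κ, fun _ => s, fun _ => 1, fun (p q : Fin 1) => ?_⟩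
    refine (key p q).trans (h.trans ?_)
    rw [Subsingleton.elim p 0, Subsingleton.elim q 0]
    rfl

theorem isSignedBlock_pair {n : ℕ} {v : Fin n → Fin n → ℤ} {A I : Fin n → Prop}
    {a b i j : Fin n} (hab : a ≠ b) (hij : i ≠ j) (hA : ∀ x, A x ↔ x = a ∨ x = b)
    (hI : ∀ x, I x ↔ x = i ∨ x = j) (hia : v i a * v i a = 1) (hib : v i b * v i b = 1)
    (hjb : v j b * v j b = 1) (hv : v i a * v j a + v i b * v j b = 0) : IsSignedBlock v A I := by
  obtain ⟨ρ, hρ₀, hρ₁⟩ := exists_equiv_fin_two hab hA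
  obtain ⟨κ, hκ₀, hκ₁⟩ := exists_equiv_fin_two hij hI
  let x : ℤˣ := ⟨v i a, v i a, hia, hia⟩
  let y : ℤˣ := ⟨v i b, v i b, hib, hib⟩
  let w : ℤˣ := ⟨v j b, v j b, hjb, hjb⟩
  -- The row signs turn the first column into `(1, 1)`; the second column sign makes its lower entry
  -- `1`, and orthogonality makes the upper one `-1`.
  refine ⟨Block.rot, ρ, κ, ![x, y], ![1, y * w], fun p q => ?_⟩
  change Fin 2 at p q
  have hyw : (v i b * v j b) * (v i b * v j b) = 1 := by
    linear_combination (v j b * v j b) * hib + hjb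
  fin_cases p <;> fin_cases q
  · change v i a * (1 * v (κ 0) (ρ 0)) = 1
    rw [hκ₀, hρ₀]; linarith
  · change v i a * ((v i b * v j b) * v (κ 1) (ρ 0)) = -1
    rw [hκ₁, hρ₀]; linear_combination (v i b * v j b) * hv - hyw
  · change v i b * (1 * v (κ 0) (ρ 1)) = 1
    rw [hκ₀, hρ₁]; linarith
  · change v i b * ((v i b * v j b) * v (κ 1) (ρ 1)) = 1
    rw [hκ₁, hρ₁]; linear_combination hyw

theorem dotProduct_eq_of_supp_subset_pair {n : ℕ} {w u : Fin n → ℤ} {a b : Fin n} (hab : a ≠ b)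
    (hw : supp w = {a, b}) : w ⬝ᵥ u = w a * u a + w b * u b := by
  rw [← Finset.sum_pair (f := fun x => w x * u x) hab, ← hw]
  refine (Finset.sum_subset (subset_univ _) fun x _ hx => ?_).symm
  simp only [mem_supp, not_not] at hx
  simp [hx]

/-- The vectors with the same support as `v i` form a block. -/
theorem CubeCondition.isSignedBlock {n : ℕ} {v : Fin n → Fin n → ℤ} (h : CubeCondition v)
    (h0 : ∀ i, v i ≠ 0) (hv : ∀ i j, i ≠ j → v i ⬝ᵥ v j = 0) (i : Fin n) :
    IsSignedBlock v (fun a => a ∈ supp (v i)) (fun j => supp (v j) = supp (v i)) := by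
  by_cases hex : ∃ j a, i ≠ j ∧ v i a ≠ 0 ∧ v j a ≠ 0
  · obtain ⟨j, a', hij, hia', hja'⟩ := hex
    obtain ⟨hs, hc, hi⟩ := h.supp_eq_of_overlap hv hij hia' hja'
    obtain ⟨-, -, hj⟩ := h.supp_eq_of_overlap hv hij.symm hja' hia'
    obtain ⟨a, b, hab, hsab⟩ := Finset.card_eq_two.1 hc
    have hne : ∀ k, supp (v k) = supp (v i) → v k a ≠ 0 ∧ v k b ≠ 0 := fun k hk => by
      constructor <;> rw [← mem_supp, hk, hsab] <;> simp
    have hdot : ∀ k l, supp (v k) = supp (v i) → k ≠ l →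
        v k a * v l a + v k b * v l b = 0 := fun k l hk hkl => by
      rw [← dotProduct_eq_of_supp_subset_pair hab (hk.trans hsab), hv k l hkl]
    have hia := sq_eq_one_of_abs_le_one (hi a) (hne i rfl).1
    have hib := sq_eq_one_of_abs_le_one (hi b) (hne i rfl).2
    have hjb := sq_eq_one_of_abs_le_one (hj b) (hne j hs).2
    refine isSignedBlock_pair hab hij (fun x => by simp [hsab]) (fun k => ?_) hia hib hjb
      (hdot i j rfl hij)
    refine ⟨fun hk => ?_, ?_⟩
    -- A third vector with this support would give three pairwise orthogonal nonzero vectors in a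
    -- plane.
    · by_contra! hcon
      have e₁ := hdot i j rfl hij
      have e₂ := hdot i k rfl hcon.1.symm
      have e₃ := hdot j k hs hcon.2.symm
      have : 2 * (v j a * v k a) = 0 := by
        linear_combination (v i a * v k a) * e₁ - (v i b * v j b) * e₂ -
          (v j a * v k a) * hia + (v j b * v k b) * hib + e₃
      exact mul_ne_zero two_ne_zero (mul_ne_zero (hne j hs).1 (hne k hk).1) this
    · rintro (rfl | rfl)
      · rfl
      · exact hs
  · push Not at hex
    obtain ⟨a, ha⟩ := Function.ne_iff.1 (h0 i)
    have hs := supp_eq_singleton h0 hv ha fun j hj => hex j a hj.symm ha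
    refine isSignedBlock_singleton (a := a) (i := i) (fun x => by simp [hs]) (fun j => ?_) ?_
    · refine ⟨fun hj => by_contra fun hji => ?_, fun hj => hj ▸ rfl⟩
      have := hex j a (Ne.symm hji) ha
      rw [← not_ne_iff, ← mem_supp, hj, mem_supp] at this
      exact this ha
    · rcases h.entries i with ⟨a', ha', hz⟩ | h1
      · have : a = a' := by_contra fun hne => ha (hz a hne)
        exact Or.inr (this ▸ ha')
      · exact Or.inl (le_antisymm (h1 a) (Int.one_le_abs ha))

/-- A basis that splits into signed blocks yields a block matrix in suitable bases. -/
theorem exists_isBlockMatrix_of_isSignedBlock {n m : ℕ} {Λ : Submodule ℤ (Fin n → ℤ)}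
    (v : Module.Basis (Fin n) ℤ Λ) (f g : Fin n → Fin m)
    (hblock : ∀ k, IsSignedBlock (fun i => (v i : Fin n → ℤ)) (fun a => g a = k) (fun i => f i = k))
    (hoff : ∀ i a, g a ≠ f i → (v i : Fin n → ℤ) a = 0) :
    ∃ (b : Module.Basis (Fin n) ℤ Λ) (e : Module.Basis (Fin n) ℤ (Fin n → ℤ)),
      IsOrthonormalBasis e ∧ IsBlockMatrix (e.toMatrix fun j => (b j : Fin n → ℤ)) := by
  choose β ρ κ s t hst using hblock
  let R : (Σ k, Fin (β k).size) ≃ Fin n := (Equiv.sigmaCongrRight ρ).trans (Equiv.sigmaFiberEquiv g)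
  let C : (Σ k, Fin (β k).size) ≃ Fin n := (Equiv.sigmaCongrRight κ).trans (Equiv.sigmaFiberEquiv f)
  have hn : ∑ k, (β k).size = n := by
    simpa using Fintype.card_congr R
  let E : (Σ k, Fin (β k).size) ≃ Fin n := finSigmaFinEquiv.trans (finCongr hn)
  let s' : (Σ k, Fin (β k).size) → ℤˣ := fun x => s x.1 x.2
  let t' : (Σ k, Fin (β k).size) → ℤˣ := fun x => t x.1 x.2
  let e := ((Pi.basisFun ℤ (Fin n)).reindex (R.symm.trans E)).unitsSMul
    fun i => s' (E.symm i)
  let b := (v.reindex (C.symm.trans E)).unitsSMul fun i => t' (E.symm i)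
  refine ⟨b, e, fun i j => ?_, m, β, hn, ?_⟩
  · simp only [e, Module.Basis.unitsSMul_apply, Module.Basis.reindex_apply, Pi.basisFun_apply,
      smul_dotProduct, dotProduct_smul, single_dotProduct, one_mul]
    split_ifs with hij
    · subst hij
      simp [Units.smul_def]
    · rw [Pi.single_eq_of_ne]
      · simp
      · simpa using hij
  · ext i j
    obtain ⟨⟨k, p⟩, rfl⟩ := E.surjective i
    obtain ⟨⟨l, q⟩, rfl⟩ := E.surjective j
    have lhs : e.toMatrix (fun j => (b j : Fin n → ℤ)) (E ⟨k, p⟩) (E ⟨l, q⟩) =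
        (s k p : ℤ) * (t l q * (v (κ l q) : Fin n → ℤ) (ρ k p)) := by
      simp only [e, b, Module.Basis.toMatrix_apply, Module.Basis.unitsSMul_apply,
        Module.Basis.repr_unitsSMul, Module.Basis.repr_reindex_apply, Module.Basis.reindex_apply,
        Pi.basisFun_repr, Units.smul_def, Equiv.symm_trans_apply, Equiv.symm_symm,
        Equiv.symm_apply_apply, Submodule.coe_smul, Pi.smul_apply, smul_eq_mul, Int.units_inv_eq_self]
      rfl
    rw [lhs, Matrix.reindex_apply, Matrix.submatrix_apply]
    change _ = Matrix.blockDiagonal' _ (E.symm (E ⟨k, p⟩)) (E.symm (E ⟨l, q⟩))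
    rw [Equiv.symm_apply_apply, Equiv.symm_apply_apply]
    by_cases hkl : k = l
    · subst hkl
      rw [Matrix.blockDiagonal'_apply_eq, hst]
    · rw [Matrix.blockDiagonal'_apply_ne _ _ _ hkl, hoff, mul_zero, mul_zero]
      rw [(ρ k p).2, (κ l q).2]
      exact hkl

theorem IsCubiquitous.exists_isBlockMatrix {n : ℕ} {Λ : Submodule ℤ (Fin n → ℤ)}
    (h : IsCubiquitous Λ) (hΛ : IsOrthogonalSublattice Λ) :
    ∃ (b : Module.Basis (Fin n) ℤ Λ) (e : Module.Basis (Fin n) ℤ (Fin n → ℤ)),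
      IsOrthonormalBasis e ∧ IsBlockMatrix (e.toMatrix fun j => (b j : Fin n → ℤ)) := by
  obtain ⟨v, hv⟩ := hΛ
  have hc := h.cubeCondition v hv
  have h0 : ∀ i, (v i : Fin n → ℤ) ≠ 0 := fun i hi => v.ne_zero i (Subtype.ext hi)
  let S : Fin n → Finset (Fin n) := fun i => supp (v i : Fin n → ℤ)
  choose r hr using exists_supp_mem h0 hv
  have hS : ∀ i a, a ∈ S i → S (r a) = S i := by
    intro i a ha
    by_cases hir : i = r a
    · rw [hir]
    · exact (hc.supp_eq_of_overlap hv hir (mem_supp.1 ha) (mem_supp.1 (hr a))).1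
  -- One block per distinct support; `r` sends a coordinate to a basis vector whose support contains
  -- it.
  let F := Fintype.equivFin (Set.range S)
  let f : Fin n → Fin (Fintype.card (Set.range S)) := fun i => F ⟨S i, i, rfl⟩
  have hf : ∀ i j, f i = f j ↔ S i = S j := fun i j =>
    F.injective.eq_iff.trans Subtype.ext_iff
  have hfr : ∀ i a, f (r a) = f i ↔ a ∈ S i := fun i a => by
    rw [hf]
    exact ⟨fun h => h ▸ hr a, hS i a⟩
  refine exists_isBlockMatrix_of_isSignedBlock v f (fun a => f (r a)) (fun k => ?_) fun i a hne => ?_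
  · obtain ⟨⟨_, i, rfl⟩, rfl⟩ := F.surjective k
    have := hc.isSignedBlock h0 hv i
    change IsSignedBlock _ (fun a => f (r a) = f i) (fun j => f j = f i)
    rw [funext fun a => propext (hfr i a), funext fun j => propext (hf j i)]
    exact this
  · rw [Ne, hfr] at hne
    simpa [S] using hne

/-! ### Block matrices give cubiquitous lattices -/

theorem IsOrthonormalBasis.sum_mul_apply {n : ℕ} {e : Module.Basis (Fin n) ℤ (Fin n → ℤ)}
    (he : IsOrthonormalBasis e) (a b : Fin n) : ∑ i, e i a * e i b = if a = b then 1 else 0 := by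
  have h : Matrix.of (fun i a => e i a) * (Matrix.of fun i a => e i a).transpose = 1 := by
    ext i j
    rw [Matrix.one_apply, ← he i j]
    rfl
  have h' := mul_eq_one_comm.1 h
  have := congrArg (fun N : Matrix (Fin n) (Fin n) ℤ => N a b) h'
  simpa only [Matrix.one_apply, Matrix.mul_apply, Matrix.transpose_apply, Matrix.of_apply] using this

/-- Each coordinate is seen by exactly one vector of an orthonormal integral basis, and that vector
sees no other coordinate. -/
theorem IsOrthonormalBasis.exists_eq_single {n : ℕ} {e : Module.Basis (Fin n) ℤ (Fin n → ℤ)}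
    (he : IsOrthonormalBasis e) (a : Fin n) :
    ∃ i, e i a * e i a = 1 ∧ (∀ j, j ≠ i → e j a = 0) ∧ ∑ b, e i b = e i a := by
  have key : ∀ w : Fin n → ℤ, ∑ i, w i * w i = 1 →
      ∃ i, w i * w i = 1 ∧ ∀ j, j ≠ i → w j = 0 := by
    intro w hw
    obtain ⟨i, hi⟩ : ∃ i, w i ≠ 0 := by
      by_contra! hcon
      simp [hcon] at hw
    have h1 : 1 ≤ w i * w i := by
      have := mul_self_pos.2 hi
      omega
    have h2 := Finset.add_sum_erase univ (fun i => w i * w i) (mem_univ i)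
    have h3 : 0 ≤ ∑ j ∈ univ.erase i, w j * w j := Finset.sum_nonneg fun j _ => mul_self_nonneg _
    simp only [hw] at h2
    refine ⟨i, by linarith, fun j hj => ?_⟩
    have h4 : ∑ j ∈ univ.erase i, w j * w j = 0 := by linarith
    exact mul_self_eq_zero.1 <| (Finset.sum_eq_zero_iff_of_nonneg fun j _ => mul_self_nonneg _).1 h4 j
      (mem_erase.2 ⟨hj, mem_univ j⟩)
  obtain ⟨i, hi, hi'⟩ := key (fun i => e i a) (by rw [he.sum_mul_apply, if_pos rfl])
  refine ⟨i, hi, hi', ?_⟩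
  obtain ⟨b, -, hb⟩ := key (e i) (by simpa [dotProduct] using he i i)
  have hab : a = b := by
    by_contra hne
    simp [hb a hne] at hi
  subst hab
  exact Finset.sum_eq_single a (fun c _ hc => hb c hc) (by simp)

/-- The images of the blocks are everything, the even integers, and the pairs with even sum. Since
each `s p` is odd, altering at most the first coordinate by it repairs the parity. -/
theorem Block.exists_mulVec_eq (β : Block) (y s : Fin β.size → ℤ) (hs : ∀ p, s p * s p = 1) :
    ∃ c z : Fin β.size → ℤ, (∀ p, c p = 0 ∨ c p = s p) ∧ ∀ p, ∑ q, β.mat p q * z q = y p + c p := by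
  have hodd : ∀ {x : ℤ}, x * x = 1 → x % 2 = 1 := fun {x} hx => by
    rcases mul_self_eq_one_iff.1 hx with rfl | rfl <;> rfl
  cases β with
  | one =>
    change Fin 1 → ℤ at y s
    refine ⟨fun _ => 0, y, fun _ => Or.inl rfl, fun (p : Fin 1) => ?_⟩
    change ∑ q : Fin 1, !![(1 : ℤ)] p q * y q = y p + 0
    fin_cases p
    simp
  | two =>
    change Fin 1 → ℤ at y s
    have := hodd (hs (0 : Fin 1))
    obtain ⟨c, hc, z, hz⟩ : ∃ c : ℤ, (c = 0 ∨ c = s 0) ∧ ∃ z, y 0 + c = 2 * z := by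
      rcases Int.even_or_odd' (y 0) with ⟨z, hz | hz⟩
      · exact ⟨0, Or.inl rfl, z, by omega⟩
      · exact ⟨s 0, Or.inr rfl, (y 0 + s 0) / 2, by omega⟩
    refine ⟨fun _ => c, fun _ => z, fun (p : Fin 1) => ?_, fun (p : Fin 1) => ?_⟩
    · rw [Subsingleton.elim p 0]; exact hc
    · change ∑ q : Fin 1, !![(2 : ℤ)] p q * z = y p + c
      fin_cases p
      simp [hz]
  | rot =>
    change Fin 2 → ℤ at y s
    have := hodd (hs (0 : Fin 2))
    obtain ⟨c, hc, z, hz⟩ : ∃ c : ℤ, (c = 0 ∨ c = s 0) ∧ ∃ z, y 0 + c + y 1 = 2 * z := by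
      rcases Int.even_or_odd' (y 0 + y 1) with ⟨z, hz | hz⟩
      · exact ⟨0, Or.inl rfl, z, by omega⟩
      · exact ⟨s 0, Or.inr rfl, (y 0 + s 0 + y 1) / 2, by omega⟩
    refine ⟨(![c, 0] : Fin 2 → ℤ), (![z, y 1 - z] : Fin 2 → ℤ), fun (p : Fin 2) => ?_,
      fun (p : Fin 2) => ?_⟩
    · fin_cases p
      · exact hc
      · exact Or.inl rfl
    · change ∑ q : Fin 2, !![(1 : ℤ), -1; 1, 1] p q * (![z, y 1 - z] : Fin 2 → ℤ) q
        = y p + (![c, 0] : Fin 2 → ℤ) p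
      fin_cases p <;> simp [Fin.sum_univ_two]
      linarith

theorem IsBlockMatrix.exists_mulVec_eq {n : ℕ} {M : Matrix (Fin n) (Fin n) ℤ} (hM : IsBlockMatrix M)
    (y s : Fin n → ℤ) (hs : ∀ i, s i * s i = 1) :
    ∃ c z : Fin n → ℤ, (∀ i, c i = 0 ∨ c i = s i) ∧ M.mulVec z = y + c := by
  obtain ⟨m, β, h, rfl⟩ := hM
  set E : (Σ k, Fin (β k).size) ≃ Fin n := finSigmaFinEquiv.trans (finCongr h)
  choose c z hc hz using fun k => (β k).exists_mulVec_eq (fun p => y (E ⟨k, p⟩))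
    (fun p => s (E ⟨k, p⟩)) fun p => hs _
  refine ⟨fun i => c (E.symm i).1 (E.symm i).2, fun i => z (E.symm i).1 (E.symm i).2,
    fun i => ?_, ?_⟩
  · simpa using hc (E.symm i).1 (E.symm i).2
  · ext i
    obtain ⟨⟨k, p⟩, rfl⟩ := E.surjective i
    simp only [Matrix.mulVec, dotProduct, Matrix.reindex_apply, Matrix.submatrix_apply,
      Pi.add_apply]
    rw [E.symm.sum_comp fun x => Matrix.blockDiagonal' (fun k => (β k).mat) (E.symm (E ⟨k, p⟩)) x *
      z x.1 x.2, Equiv.symm_apply_apply, Fintype.sum_sigma, Finset.sum_eq_single k]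
    · simp only [Matrix.blockDiagonal'_apply_eq]
      exact hz k p
    · intro l _ hl
      exact Finset.sum_eq_zero fun q _ => by
        rw [Matrix.blockDiagonal'_apply_ne _ _ _ hl.symm, zero_mul]
    · simp

theorem isCubiquitous_of_isBlockMatrix {n : ℕ} {Λ : Submodule ℤ (Fin n → ℤ)}
    (b : Module.Basis (Fin n) ℤ Λ) (e : Module.Basis (Fin n) ℤ (Fin n → ℤ))
    (he : IsOrthonormalBasis e) (hM : IsBlockMatrix (e.toMatrix fun j => (b j : Fin n → ℤ))) :
    IsCubiquitous Λ := by
  intro x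
  have hs : ∀ i, (∑ a, e i a) * (∑ a, e i a) = 1 := by
    intro i
    obtain ⟨a, ha⟩ : ∃ a, e i a ≠ 0 := Function.ne_iff.1 (e.ne_zero i)
    obtain ⟨j, hj, hj', hj''⟩ := he.exists_eq_single a
    have hij : i = j := by_contra fun hne => ha (hj' i hne)
    rw [hij, hj'', hj]
  -- Each `e i` has a single nonzero entry, so its coordinate sum is its sign; the choice `c i ∈ {0,
  -- sign}` makes `c i • e i` zero or a standard basis vector.
  obtain ⟨c, z, hc, hz⟩ := hM.exists_mulVec_eq (e.repr x) (fun i => ∑ a, e i a) hs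
  refine ⟨∑ i, c i • e i, fun a => ?_, ?_⟩
  · obtain ⟨i, hi, hi', hi''⟩ := he.exists_eq_single a
    have : (∑ i, c i • e i) a = c i * e i a := by
      rw [Finset.sum_apply]
      exact Finset.sum_eq_single i (fun j _ hj => by simp [hi' j hj]) (by simp)
    rw [this]
    rcases hc i with h | h
    · simp [h]
    · right; rw [h, hi'', hi]
  · have : x + ∑ i, c i • e i = ∑ j, z j • (b j : Fin n → ℤ) := by
      refine e.repr.injective (Finsupp.ext fun i => ?_)
      have hzi := congrFun hz i
      rw [map_add, map_sum, map_sum, Finsupp.add_apply, Finsupp.finsetSum_apply,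
        Finsupp.finsetSum_apply]
      simp only [map_smul, Finsupp.smul_apply, Module.Basis.repr_self, smul_eq_mul,
        Finsupp.single_apply, mul_ite, mul_one, mul_zero, Finset.sum_ite_eq', Finset.mem_univ,
        if_true]
      rw [Pi.add_apply] at hzi
      rw [← hzi, Matrix.mulVec, dotProduct]
      exact Finset.sum_congr rfl fun j _ => mul_comm (e.repr (b j : Fin n → ℤ) i) (z j)
    rw [this]
    exact Submodule.sum_mem _ fun j _ => Submodule.smul_mem _ _ (b j).2

end CubLat

theorem mainTheorem1 (n : ℕ) (Λ : Submodule ℤ (Fin n → ℤ))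
    (hΛ : CubLat.IsOrthogonalSublattice Λ) :
    CubLat.IsCubiquitous Λ ↔
      ∃ (b : Module.Basis (Fin n) ℤ Λ) (e : Module.Basis (Fin n) ℤ (Fin n → ℤ)),
        CubLat.IsOrthonormalBasis e ∧
          CubLat.IsBlockMatrix (e.toMatrix fun j => (b j : Fin n → ℤ)) :=
  ⟨fun h => h.exists_isBlockMatrix hΛ,
    fun ⟨b, e, he, hM⟩ => CubLat.isCubiquitous_of_isBlockMatrix b e he hM⟩
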